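/- All graphs are finite and simple. A perfect Roman dominating function on a graph $G=(V,E)$ is a function $f:V\to\{0,1,2\}$ such that every vertex $u$ with $f(u)=0$ is adjacent to exactly one vertex $v$ with $f(v)=2$. Its weight is $\sum_{u\in V}f(u)$, and the perfect Roman domination number $\gamma_R^p(G)$ is the minimum weight of a perfect Roman dominating function on $G$. The graph $G$ is perfect Roman domination stable if $\gamma_R^p(G-v)=\gamma_R^p(G)$ for every vertex $v\in V$, where $G-v$ is obtained from $G$ by deleting $v$ and all edges incident with it. Let $T$ be a perfect Roman domination stable tree with $n$ vertices. Then $n\equiv 0\pmod 3$ and $\gamma_R^p(T)=\frac{2n}{3}$. -/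

import Mathlib

/-- A perfect Roman dominating function: every vertex `u` with `f u = 0` is adjacent to exactly
one vertex `v` with `f v = 2`. -/
def SimpleGraph.IsPerfectRomanDominating {V : Type*} (G : SimpleGraph V) (f : V → Fin 3) : Prop :=
  ∀ u, f u = 0 → ∃! v, G.Adj u v ∧ f v = 2

/-- The weight `w(f)`, the sum of all values of `f`. -/
def romanWeight {V : Type*} [Fintype V] (f : V → Fin 3) : ℕ :=
  ∑ u, (f u : ℕ)

/-- The perfect Roman domination number: the minimum weight of a perfect Roman dominating
function. -/
noncomputable def SimpleGraph.perfectRomanDominationNumber {V : Type*} [Fintype V]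
    (G : SimpleGraph V) : ℕ :=
  sInf {w | ∃ f : V → Fin 3, G.IsPerfectRomanDominating f ∧ romanWeight f = w}

/-- The minimum in the definition is attained: the constant function `1` shows that the set of
weights is never empty. -/
theorem SimpleGraph.isLeast_perfectRomanDominationNumber {V : Type*} [Fintype V]
    (G : SimpleGraph V) :
    IsLeast {w | ∃ f : V → Fin 3, G.IsPerfectRomanDominating f ∧ romanWeight f = w}
      G.perfectRomanDominationNumber := by
  have hne : {w | ∃ f : V → Fin 3, G.IsPerfectRomanDominating f ∧ romanWeight f = w}.Nonempty :=
    ⟨_, fun _ => 1, fun u hu => absurd hu (show (1 : Fin 3) ≠ 0 by decide), rfl⟩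
  exact ⟨Nat.sInf_mem hne, fun w hw => Nat.sInf_le hw⟩

/-- A graph is perfect Roman domination stable if deleting any one vertex leaves the perfect Roman
domination number unchanged. The graph `G - v` is the subgraph induced on the vertices other
than `v`. -/
def SimpleGraph.IsPerfectRomanDominationStable {V : Type*} [Fintype V] [DecidableEq V]
    (G : SimpleGraph V) : Prop :=
  ∀ v : V, (G.induce {w | w ≠ v}).perfectRomanDominationNumber = G.perfectRomanDominationNumber

/-!
Let `T` be a stable tree and `f` a perfect Roman dominating function of minimum weight `w`. By
stability, no perfect Roman dominating function of `T` or of any `T - x` has weight less than `w`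
(`SimpleGraph.IsDeletionMinimal`). A vertex of value `1` could be deleted together with its weight,
so `f` takes only the values `0` and `2`, and every vertex of value `0` is dominated by a unique
vertex of value `2`. It remains to see that every `v` with `f v = 2` dominates exactly two
vertices: then the vertices fall into triples of weight `2`.

If `v` dominates `k` vertices, deleting `v` and giving them the value `1` yields a competitor of
weight `w - 2 + k`, so `k ≥ 2` (`two_le_card`).

For `k ≤ 2` (`card_le_two`), stability provides a function `q` of weight exactly `w` on `T - v`,
which is compared with `f` on each branch of `T - v`. All comparisons are hybrids: use one function
on one side of an edge and `f` on the other, possibly with a vertex near the edge deleted to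
remove a conflict. On the branch at a neighbor `u` of `v`, the weight of `q` is at least that of
`f`, and strictly larger if `f u = 0` (`sum_side_add_le`). Summing over the branches gives
`w ≥ (w - 2) + k`. The strict inequality rests on `sum_side_lt_of_eq_two`: changing the value of a
vertex from `0` to `2` on its side of an edge always increases the weight there.
-/

namespace SimpleGraph

open Finset

/-! ### Perfect Roman domination on vertex sets, and gluing -/

section Gluing

variable {V : Type*} {G : SimpleGraph V}

/-- `f` is perfect Roman dominating on the subgraph of `G` induced on `S`. The function is defined
on all of `V`, but only its values on `S` matter; this lets functions on different induced
subgraphs be compared and glued without passing to subtypes. -/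
def IsPerfectRomanDominatingOn (G : SimpleGraph V) (S : Finset V) (f : V → Fin 3) : Prop :=
  ∀ u ∈ S, f u = 0 → ∃! v, v ∈ S ∧ G.Adj u v ∧ f v = 2

theorem isPerfectRomanDominatingOn_univ [Fintype V] {f : V → Fin 3} :
    G.IsPerfectRomanDominatingOn univ f ↔ G.IsPerfectRomanDominating f := by
  simp [IsPerfectRomanDominatingOn, IsPerfectRomanDominating]

theorem IsPerfectRomanDominatingOn.mono {A S : Finset V} {f : V → Fin 3}
    (hf : G.IsPerfectRomanDominatingOn A f) (hSA : S ⊆ A)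
    (h : ∀ x ∈ S, ∀ y ∈ A, y ∉ S → G.Adj x y → f x = 0 → f y ≠ 2) :
    G.IsPerfectRomanDominatingOn S f := by
  intro x hx hx0
  obtain ⟨y, ⟨hyA, hxy, hy2⟩, huniq⟩ := hf x (hSA hx) hx0
  refine ⟨y, ⟨?_, hxy, hy2⟩, fun z hz => huniq z ⟨hSA hz.1, hz.2⟩⟩
  by_contra hyS
  exact h x hx y hyA hyS hxy hx0 hy2

/-- Perfect Roman dominating functions on disjoint sets glue together, provided that no edge between
the two sets joins a vertex of value `0` to one of value `2`. -/
theorem IsPerfectRomanDominatingOn.glue [DecidableEq V] {A B : Finset V} {p q : V → Fin 3}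
    (hp : G.IsPerfectRomanDominatingOn A p) (hq : G.IsPerfectRomanDominatingOn B q)
    (hAB : Disjoint A B)
    (h : ∀ x ∈ A, ∀ y ∈ B, G.Adj x y → (p x = 0 → q y ≠ 2) ∧ (q y = 0 → p x ≠ 2)) :
    G.IsPerfectRomanDominatingOn (A ∪ B) (A.piecewise p q) ∧
      ∑ x ∈ A ∪ B, (A.piecewise p q x : ℕ) = ∑ x ∈ A, (p x : ℕ) + ∑ x ∈ B, (q x : ℕ) := by
  have hA : ∀ x ∈ A, A.piecewise p q x = p x := fun x hx => A.piecewise_eq_of_mem _ _ hx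
  have hB : ∀ x ∈ B, A.piecewise p q x = q x := fun x hx =>
    A.piecewise_eq_of_notMem _ _ (Finset.disjoint_right.1 hAB hx)
  refine ⟨?_, ?_⟩
  · intro x hx hx0
    rcases mem_union.1 hx with hxA | hxB
    · rw [hA x hxA] at hx0
      obtain ⟨y, ⟨hy, hxy, hy2⟩, huniq⟩ := hp x hxA hx0
      refine ⟨y, ⟨mem_union_left _ hy, hxy, by rw [hA y hy, hy2]⟩, ?_⟩
      rintro z ⟨hz, hxz, hz2⟩
      rcases mem_union.1 hz with hz' | hz'
      · exact huniq z ⟨hz', hxz, by rw [← hA z hz', hz2]⟩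
      · exact absurd (by rw [← hB z hz', hz2]) ((h x hxA z hz' hxz).1 hx0)
    · rw [hB x hxB] at hx0
      obtain ⟨y, ⟨hy, hxy, hy2⟩, huniq⟩ := hq x hxB hx0
      refine ⟨y, ⟨mem_union_right _ hy, hxy, by rw [hB y hy, hy2]⟩, ?_⟩
      rintro z ⟨hz, hxz, hz2⟩
      rcases mem_union.1 hz with hz' | hz'
      · exact absurd (by rw [← hA z hz', hz2]) ((h z hz' x hxB hxz.symm).2 hx0)
      · exact huniq z ⟨hz', hxz, by rw [← hB z hz', hz2]⟩
  · rw [sum_union hAB]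
    congr 1
    · exact sum_congr rfl fun x hx => by rw [hA x hx]
    · exact sum_congr rfl fun x hx => by rw [hB x hx]

end Gluing

/-! ### The two sides of an edge of a tree -/

section Sides

variable {V : Type*} [Fintype V] {T : SimpleGraph V}

open Classical in
/-- For an edge `a b` of a tree `T`, the vertex set of the component of `b` after removal of that
edge; equivalently, of the component of `T - a` that contains `b`. -/
noncomputable def side (T : SimpleGraph V) (a b : V) : Finset V :=
  univ.filter fun x => (T.deleteEdges {s(a, b)}).Reachable b x

theorem mem_side_self (a b : V) : b ∈ T.side a b := by simp [side]

theorem IsTree.notMem_side (hT : T.IsTree) {a b : V} (h : T.Adj a b) : a ∉ T.side a b := by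
  have hb := isAcyclic_iff_forall_adj_isBridge.1 hT.isAcyclic h
  simp only [side, mem_filter, mem_univ, true_and]
  intro hr
  exact (isBridge_iff.1 hb) hr.symm

/-- The only edge leaving `side a b` is the edge `b a`. -/
theorem IsTree.eq_of_adj_of_mem_side (hT : T.IsTree) {a b x y : V} (h : T.Adj a b)
    (hx : x ∈ T.side a b) (hy : y ∉ T.side a b) (hxy : T.Adj x y) : x = b ∧ y = a := by
  have ha := hT.notMem_side h
  have hs : s(x, y) = s(a, b) := by
    by_contra hne
    apply hy
    simp only [side, mem_filter, mem_univ, true_and] at hx ⊢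
    refine hx.trans (Adj.reachable ?_)
    simp [deleteEdges_adj, hxy, hne]
  rcases Sym2.eq_iff.1 hs with ⟨rfl, rfl⟩ | ⟨rfl, rfl⟩
  · exact absurd hx ha
  · exact ⟨rfl, rfl⟩

/-- In a connected graph, a nonempty set of vertices that no edge leaves is everything. -/
theorem Connected.mem_of_closed {W : Type*} {G : SimpleGraph W} (hG : G.Connected) {P : W → Prop}
    (hP : ∀ x y, G.Adj x y → P x → P y) {x : W} (hx : P x) (y : W) : P y := by
  obtain ⟨p⟩ := hG.preconnected x y
  induction p with
  | nil => exact hx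
  | cons h _ ih => exact ih (hP _ _ h hx)

theorem IsTree.notMem_side_iff (hT : T.IsTree) {a b : V} (h : T.Adj a b) (x : V) :
    x ∉ T.side a b ↔ x ∈ T.side b a := by
  constructor
  · intro hx
    have := hT.connected.mem_of_closed (P := fun x => x ∈ T.side a b ∨ x ∈ T.side b a)
      (fun y z hyz hy => ?_) (Or.inl (mem_side_self a b)) x
    · tauto
    · by_contra! hz
      rcases hy with hy | hy
      · obtain ⟨-, rfl⟩ := hT.eq_of_adj_of_mem_side h hy hz.1 hyz
        exact hz.2 (mem_side_self _ _)
      · obtain ⟨-, rfl⟩ := hT.eq_of_adj_of_mem_side h.symm hy hz.2 hyz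
        exact hz.1 (mem_side_self _ _)
  · intro hx hx'
    refine hT.notMem_side h (hT.connected.mem_of_closed
      (P := fun x => x ∈ T.side a b ∧ x ∈ T.side b a) (fun y z hyz hy => ?_) ⟨hx', hx⟩ a).1
    by_contra hz
    rw [not_and_or] at hz
    rcases hz with hz | hz
    · obtain ⟨rfl, -⟩ := hT.eq_of_adj_of_mem_side h hy.1 hz hyz
      exact hT.notMem_side h.symm hy.2
    · obtain ⟨rfl, -⟩ := hT.eq_of_adj_of_mem_side h.symm hy.2 hz hyz
      exact hT.notMem_side h hy.1

theorem IsTree.disjoint_side (hT : T.IsTree) {r e e' : V} (h : T.Adj r e) (h' : T.Adj r e')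
    (hne : e ≠ e') : Disjoint (T.side r e) (T.side r e') := by
  have key : ∀ {c d : V}, T.Adj r c → T.Adj r d → c ∈ T.side r d → c = d := fun hc hd hm =>
    (hT.eq_of_adj_of_mem_side hd hm (hT.notMem_side hd) hc.symm).1
  rw [Finset.disjoint_left]
  intro x hx hx'
  refine hT.notMem_side h (hT.connected.mem_of_closed
    (P := fun x => x ∈ T.side r e ∧ x ∈ T.side r e') (fun y z hyz hy => ?_) ⟨hx, hx'⟩ r).1
  by_contra hz
  rw [not_and_or] at hz
  rcases hz with hz | hz
  · obtain ⟨rfl, -⟩ := hT.eq_of_adj_of_mem_side h hy.1 hz hyz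
    exact hne (key h h' hy.2)
  · obtain ⟨rfl, -⟩ := hT.eq_of_adj_of_mem_side h' hy.2 hz hyz
    exact hne (key h' h hy.1).symm

theorem IsTree.exists_mem_side (hT : T.IsTree) {r x : V} (hx : x ≠ r) :
    ∃ e, T.Adj r e ∧ x ∈ T.side r e := by
  refine (hT.connected.mem_of_closed
    (P := fun x => x = r ∨ ∃ e, T.Adj r e ∧ x ∈ T.side r e) (fun y z hyz hy => ?_)
    (Or.inl rfl) x).resolve_left hx
  rcases hy with rfl | ⟨e, he, hy⟩
  · exact Or.inr ⟨z, hyz, mem_side_self _ _⟩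
  · by_cases hz : z ∈ T.side r e
    · exact Or.inr ⟨e, he, hz⟩
    · exact Or.inl (hT.eq_of_adj_of_mem_side he hy hz hyz).2

theorem IsTree.side_subset_side (hT : T.IsTree) {a r e : V} (h : T.Adj a r) (he : T.Adj r e)
    (hne : e ≠ a) : T.side r e ⊆ T.side a r := by
  intro x hx
  by_contra hx'
  rw [hT.notMem_side_iff h] at hx'
  exact Finset.disjoint_left.1 (hT.disjoint_side he h.symm hne) hx hx'

variable [DecidableEq V]

open Classical in
theorem IsTree.sum_compl_singleton (hT : T.IsTree) (r : V) (w : V → ℕ) :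
    ∑ x ∈ {r}ᶜ, w x = ∑ e with T.Adj r e, ∑ x ∈ T.side r e, w x := by
  rw [← sum_biUnion]
  · congr 1
    ext x
    simp only [mem_compl, mem_singleton, mem_biUnion, mem_filter, mem_univ, true_and]
    refine ⟨fun hx => hT.exists_mem_side hx, ?_⟩
    rintro ⟨e, he, hx⟩ rfl
    exact hT.notMem_side he hx
  · intro e he e' he' hne
    simp only [coe_filter, mem_univ, true_and, Set.mem_ofPred_eq] at he he'
    exact hT.disjoint_side he he' hne

open Classical in
theorem IsTree.sum_side (hT : T.IsTree) {a r : V} (h : T.Adj a r) (w : V → ℕ) :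
    ∑ x ∈ T.side a r, w x =
      w r + ∑ e with T.Adj r e ∧ e ≠ a, ∑ x ∈ T.side r e, w x := by
  rw [← add_sum_erase _ _ (mem_side_self a r), ← sum_biUnion]
  · congr 2
    ext x
    simp only [mem_erase, mem_biUnion, mem_filter, mem_univ, true_and]
    constructor
    · rintro ⟨hxr, hx⟩
      obtain ⟨e, he, hxe⟩ := hT.exists_mem_side hxr
      refine ⟨e, ⟨he, ?_⟩, hxe⟩
      rintro rfl
      exact (hT.notMem_side_iff h x).2 hxe hx
    · rintro ⟨e, ⟨he, hea⟩, hx⟩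
      refine ⟨?_, hT.side_subset_side h he hea hx⟩
      rintro rfl
      exact hT.notMem_side he hx
  · intro e he e' he' hne
    simp only [coe_filter, mem_univ, true_and, Set.mem_ofPred_eq] at he he'
    exact hT.disjoint_side he.1 he'.1 hne

end Sides

/-! ### Functions that are minimal under vertex deletion -/

section DeletionMinimal

variable {V : Type*} [Fintype V] [DecidableEq V] {T : SimpleGraph V} {f q : V → Fin 3}

/-- A perfect Roman dominating function `f` of `T` that weighs no more than any perfect Roman
dominating function of `T` or of `T - x`, for every vertex `x`. In a stable graph these are the
functions of minimum weight. -/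
structure IsDeletionMinimal (T : SimpleGraph V) (f : V → Fin 3) : Prop where
  dominating : T.IsPerfectRomanDominatingOn univ f
  le_univ : ∀ h, T.IsPerfectRomanDominatingOn univ h → ∑ x, (f x : ℕ) ≤ ∑ x, (h x : ℕ)
  le_compl : ∀ v h, T.IsPerfectRomanDominatingOn {v}ᶜ h →
    ∑ x, (f x : ℕ) ≤ ∑ x ∈ {v}ᶜ, (h x : ℕ)

namespace IsDeletionMinimal

theorem ne_one (hf : T.IsDeletionMinimal f) (v : V) : f v ≠ 1 := by
  intro hv
  have h := hf.le_compl v f (hf.dominating.mono (subset_univ _) fun x _ y _ hy _ _ => by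
    simp only [mem_compl, mem_singleton, not_not] at hy
    simp [hy, hv])
  rw [Fintype.sum_eq_add_sum_compl v, hv] at h
  simp at h

theorem eq_zero_or_eq_two (hf : T.IsDeletionMinimal f) (v : V) : f v = 0 ∨ f v = 2 := by
  have h1 := hf.ne_one v
  generalize f v = a at *
  revert a
  decide

theorem eq_of_adj (hf : T.IsDeletionMinimal f) {x y z : V} (hx : f x = 0) (hxy : T.Adj x y)
    (hy : f y = 2) (hxz : T.Adj x z) (hz : f z = 2) : y = z :=
  (hf.dominating x (mem_univ x) hx).unique ⟨mem_univ y, hxy, hy⟩ ⟨mem_univ z, hxz, hz⟩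

/-- Replacing `f` by `p` on `S` cannot lower the weight. -/
theorem sum_le_of_glue_univ (hf : T.IsDeletionMinimal f) {S : Finset V} {p : V → Fin 3}
    (hp : T.IsPerfectRomanDominatingOn S p) (hfS : T.IsPerfectRomanDominatingOn Sᶜ f)
    (h : ∀ x ∈ S, ∀ y ∉ S, T.Adj x y → (p x = 0 → f y ≠ 2) ∧ (f y = 0 → p x ≠ 2)) :
    ∑ x ∈ S, (f x : ℕ) ≤ ∑ x ∈ S, (p x : ℕ) := by
  obtain ⟨hg, hsum⟩ := hp.glue hfS disjoint_compl_right
    fun x hx y hy => h x hx y (mem_compl.1 hy)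
  rw [union_compl] at hg hsum
  have := hf.le_univ _ hg
  rw [hsum, ← sum_add_sum_compl S] at this
  omega

/-- Deleting `v` and replacing `f` by `p` on the rest of `S` cannot lower the weight. -/
theorem sum_le_of_glue_erase (hf : T.IsDeletionMinimal f) {S : Finset V} {v : V} (hv : v ∈ S)
    {p : V → Fin 3} (hp : T.IsPerfectRomanDominatingOn (S.erase v) p)
    (hfS : T.IsPerfectRomanDominatingOn Sᶜ f)
    (h : ∀ x ∈ S.erase v, ∀ y ∉ S, T.Adj x y → (p x = 0 → f y ≠ 2) ∧ (f y = 0 → p x ≠ 2)) :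
    ∑ x ∈ S, (f x : ℕ) ≤ ∑ x ∈ S.erase v, (p x : ℕ) := by
  have hd : Disjoint (S.erase v) Sᶜ :=
    disjoint_compl_right.mono_left (erase_subset _ _)
  have hu : S.erase v ∪ Sᶜ = {v}ᶜ := by
    ext x
    by_cases hx : x = v <;> simp [hx, hv, em]
  obtain ⟨hg, hsum⟩ := hp.glue hfS hd fun x hx y hy => h x hx y (mem_compl.1 hy)
  rw [hu] at hg hsum
  have := hf.le_compl v _ hg
  rw [hsum, ← sum_add_sum_compl S] at this
  omega

/-- Deleting a vertex of value `0` outside `S` and replacing `f` by `p` on `S` cannot lower the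
weight, if every edge leaving `S` ends in the deleted vertex. -/
theorem sum_le_of_glue_delete (hf : T.IsDeletionMinimal f) {S : Finset V} {v : V} (hv : v ∉ S)
    (hv0 : f v = 0) {p : V → Fin 3} (hp : T.IsPerfectRomanDominatingOn S p)
    (h : ∀ x ∈ S, ∀ y ∉ S, T.Adj x y → y = v) :
    ∑ x ∈ S, (f x : ℕ) ≤ ∑ x ∈ S, (p x : ℕ) := by
  have hB : T.IsPerfectRomanDominatingOn (Sᶜ.erase v) f :=
    hf.dominating.mono (subset_univ _) fun x hx y _ hy hxy _ => by
      simp only [mem_erase, mem_compl] at hx hy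
      by_cases hyv : y = v
      · simp [hyv, hv0]
      · exact absurd (h y (by tauto) x hx.2 hxy.symm) hx.1
  have hd : Disjoint S (Sᶜ.erase v) := disjoint_compl_right.mono_right (erase_subset _ _)
  have hu : S ∪ Sᶜ.erase v = {v}ᶜ := by
    ext x
    by_cases hx : x = v <;> simp [hx, hv, em]
  obtain ⟨hg, hsum⟩ := hp.glue hB hd fun x hx y hy hxy => by
    simp only [mem_erase, mem_compl] at hy
    exact absurd (h x hx y hy.2 hxy) hy.1
  rw [hu] at hg hsum
  have := hf.le_compl v _ hg
  rw [hsum, ← sum_add_sum_compl S, ← add_sum_erase Sᶜ _ (mem_compl.2 hv), hv0] at this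
  simpa using this

theorem dominatingOn_compl_side (hf : T.IsDeletionMinimal f) (hT : T.IsTree) {a b : V}
    (h : T.Adj a b) (hab : f a = 0 → f b ≠ 2) :
    T.IsPerfectRomanDominatingOn (T.side a b)ᶜ f :=
  hf.dominating.mono (subset_univ _) fun x hx y _ hy hxy hx0 => by
    obtain ⟨rfl, rfl⟩ := hT.eq_of_adj_of_mem_side h (not_not.1 (mt mem_compl.2 hy))
      (mem_compl.1 hx) hxy.symm
    exact hab hx0

theorem sum_side_le_of_eq_zero (hf : T.IsDeletionMinimal f) (hT : T.IsTree) {r e : V}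
    (h : T.Adj r e) (hr : f r = 0) (hq : T.IsPerfectRomanDominatingOn (T.side r e) q) :
    ∑ x ∈ T.side r e, (f x : ℕ) ≤ ∑ x ∈ T.side r e, (q x : ℕ) :=
  hf.sum_le_of_glue_delete (hT.notMem_side h) hr hq fun _ hx _ hy hxy =>
    (hT.eq_of_adj_of_mem_side h hx hy hxy).2

theorem sum_side_le_erase (hf : T.IsDeletionMinimal f) (hT : T.IsTree) {r e : V}
    (h : T.Adj r e) (hre : f r = 0 → f e ≠ 2)
    (hq : T.IsPerfectRomanDominatingOn ((T.side r e).erase e) q) :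
    ∑ x ∈ T.side r e, (f x : ℕ) ≤ ∑ x ∈ (T.side r e).erase e, (q x : ℕ) :=
  hf.sum_le_of_glue_erase (mem_side_self r e) hq (hf.dominatingOn_compl_side hT h hre)
    fun _ hx _ hy hxy => absurd
      (hT.eq_of_adj_of_mem_side h (mem_of_mem_erase hx) hy hxy).1 (ne_of_mem_erase hx)

/-- When the deletion of `e` leaves `r` undominated, raising the value of `r` to `1` repairs
this at cost one. -/
theorem sum_side_le_erase_add_one (hf : T.IsDeletionMinimal f) (hT : T.IsTree) {r e : V}
    (h : T.Adj r e) (hr : f r = 0)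
    (hq : T.IsPerfectRomanDominatingOn ((T.side r e).erase e) q) :
    ∑ x ∈ T.side r e, (f x : ℕ) ≤ ∑ x ∈ (T.side r e).erase e, (q x : ℕ) + 1 := by
  have hre : r ≠ e := h.ne
  have hrS := hT.notMem_side h
  have h1 : T.IsPerfectRomanDominatingOn {r} fun _ => 1 :=
    fun _ _ h0 => absurd h0 (show (1 : Fin 3) ≠ 0 by decide)
  have hd : Disjoint ((T.side r e).erase e) {r} := by
    simp [hrS]
  obtain ⟨hg, hsum⟩ := hq.glue h1 hd fun x hx y hy hxy => by
    simp only [mem_singleton] at hy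
    subst hy
    exact absurd (hT.eq_of_adj_of_mem_side h (mem_of_mem_erase hx) hrS hxy).1 (ne_of_mem_erase hx)
  have hS : (T.side r e).erase e ∪ {r} = (insert r (T.side r e)).erase e := by
    rw [erase_insert_of_ne hre, union_comm, insert_eq]
  rw [hS] at hg hsum
  have hfS : T.IsPerfectRomanDominatingOn (insert r (T.side r e))ᶜ f :=
    hf.dominating.mono (subset_univ _) fun x hx y _ hy hxy _ => by
      simp only [mem_compl, mem_insert, not_or] at hx hy
      rcases or_iff_not_imp_left.2 fun h' => not_not.1 fun h'' => hy ⟨h', h''⟩ with rfl | hy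
      · simp [hr]
      · exact absurd (hT.eq_of_adj_of_mem_side h hy hx.2 hxy.symm).2 hx.1
  have hle := hf.sum_le_of_glue_erase (mem_insert_of_mem (mem_side_self r e)) hg hfS
    fun x hx y hy hxy => by
      simp only [mem_erase, mem_insert, not_or] at hx hy
      rcases hx.2 with rfl | hx'
      · have hval : ((T.side x e).erase e).piecewise q (fun _ => 1) x = 1 :=
          piecewise_eq_of_notMem _ _ _ (by simp [hrS])
        rw [hval]
        exact ⟨fun h0 => absurd h0 (by decide), fun _ => by decide⟩
      · exact absurd (hT.eq_of_adj_of_mem_side h hx' hy.2 hxy).1 hx.1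
  rw [hsum, sum_insert hrS, hr] at hle
  simpa using hle

/-- Inside the side `D` of an edge `a r` with `f r = 0`, giving `r` the value `2` costs more than
`f` does. The two extra units at `r` cannot be recovered: on the branch at each further neighbor
`e` of `r` at most one unit is saved, and only if `f e = 2`, which happens for at most one `e`. -/
theorem sum_side_lt_of_eq_two (hf : T.IsDeletionMinimal f) (hT : T.IsTree) {a r : V}
    (h : T.Adj a r) (hr : f r = 0) (hq : T.IsPerfectRomanDominatingOn (T.side a r) q)
    (hq2 : q r = 2) :
    ∑ x ∈ T.side a r, (f x : ℕ) < ∑ x ∈ T.side a r, (q x : ℕ) := by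
  classical
  have branch : ∀ e ∈ ({e | T.Adj r e ∧ e ≠ a} : Finset V), ∑ x ∈ T.side r e, (f x : ℕ) ≤
      ∑ x ∈ T.side r e, (q x : ℕ) + if f e = 2 then 1 else 0 := by
    intro e he
    simp only [mem_filter, mem_univ, true_and] at he
    have hsub := hT.side_subset_side h he.1 he.2
    by_cases hqe : q e = 0
    · have hq' : T.IsPerfectRomanDominatingOn ((T.side r e).erase e) q :=
        hq.mono ((erase_subset _ _).trans hsub) fun x hx y _ hy hxy _ => by
          by_cases hye : y = e
          · simp [hye, hqe]
          · exact absurd (hT.eq_of_adj_of_mem_side he.1 (mem_of_mem_erase hx)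
              (fun hy' => hy (mem_erase.2 ⟨hye, hy'⟩)) hxy).1 (ne_of_mem_erase hx)
      have hsum : ∑ x ∈ (T.side r e).erase e, (q x : ℕ) = ∑ x ∈ T.side r e, (q x : ℕ) :=
        sum_erase _ (by simp [hqe])
      split_ifs with hfe
      · rw [← hsum]
        exact hf.sum_side_le_erase_add_one hT he.1 hr hq'
      · rw [← hsum]
        exact hf.sum_side_le_erase hT he.1 (fun _ => hfe) hq'
    · refine le_add_right (hf.sum_side_le_of_eq_zero hT he.1 hr (hq.mono hsub ?_))
      intro x hx y _ hy hxy hx0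
      exact absurd ((hT.eq_of_adj_of_mem_side he.1 hx hy hxy).1 ▸ hx0) hqe
  have hone : ∑ e ∈ ({e | T.Adj r e ∧ e ≠ a} : Finset V), (if f e = 2 then 1 else 0) ≤ 1 := by
    rw [sum_boole, Nat.cast_id, card_le_one]
    simp only [mem_filter, mem_univ, true_and]
    intro x hx y hy
    exact hf.eq_of_adj hr hx.1.1 hx.2 hy.1.1 hy.2
  have hsum := sum_le_sum branch
  rw [sum_add_distrib] at hsum
  rw [hT.sum_side h, hT.sum_side h, hr, hq2]
  simp only [Fin.val_zero, Fin.val_two]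
  omega

/-- Any competitor on the branch of `T - v` at a neighbor `u`, where `f v = 2`, weighs at least as
much as `f` there, and strictly more if `f u = 0`. -/
theorem sum_side_add_le (hf : T.IsDeletionMinimal f) (hT : T.IsTree) {v u : V}
    (h : T.Adj v u) (hv : f v = 2) (hq : T.IsPerfectRomanDominatingOn (T.side v u) q) :
    ∑ x ∈ T.side v u, (f x : ℕ) + (if f u = 0 then 1 else 0) ≤ ∑ x ∈ T.side v u, (q x : ℕ) := by
  classical
  have hv0 : f v ≠ 0 := by simp [hv]
  by_cases hq2 : q u = 2
  · split_ifs with hu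
    · exact hf.sum_side_lt_of_eq_two hT h hu hq hq2
    · refine hf.sum_le_of_glue_univ hq (hf.dominatingOn_compl_side hT h fun h0 => absurd h0 hv0) ?_
      intro x hx y hy hxy
      obtain ⟨rfl, rfl⟩ := hT.eq_of_adj_of_mem_side h hx hy hxy
      exact ⟨fun h0 => by simp [hq2] at h0, fun h0 => absurd h0 hv0⟩
  -- Otherwise `u` can be deleted, so that its value under `q` is saved.
  have hq' : T.IsPerfectRomanDominatingOn ((T.side v u).erase u) q :=
    hq.mono (erase_subset _ _) fun x _ y hy hy' _ _ => by
      have : y = u := by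
        by_contra hne
        exact hy' (mem_erase.2 ⟨hne, hy⟩)
      rwa [this]
  have hle := hf.sum_side_le_erase hT h (fun h0 => absurd h0 hv0) hq'
  have hsplit := add_sum_erase (T.side v u) (fun x => (q x : ℕ)) (mem_side_self v u)
  by_cases hq0 : q u = 0
  · split_ifs with hu
    · -- Some neighbor `r` of `u` dominates it under `q`, while `f r = 0` as `v` dominates `u`
      -- under `f`: on the branch at `r` the strict inequality holds.
      obtain ⟨r, ⟨hrS, hur, hr2⟩, -⟩ := hq u (mem_side_self v u) hq0
      have hrv : r ≠ v := fun h' => hT.notMem_side h (h' ▸ hrS)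
      have hr0 : f r = 0 := (hf.eq_zero_or_eq_two r).resolve_right fun hr =>
        hrv (hf.eq_of_adj hu hur hr h.symm hv)
      have hqS : ∀ e, T.Adj u e → e ≠ v → T.IsPerfectRomanDominatingOn (T.side u e) q :=
        fun e he hev => hq.mono (hT.side_subset_side h he hev) fun x hx y _ hy hxy _ => by
          rw [(hT.eq_of_adj_of_mem_side he hx hy hxy).2, hq0]
          decide
      rw [hT.sum_side h, hT.sum_side h, hu, hq0]
      simp only [Fin.val_zero, zero_add]
      refine Nat.succ_le_of_lt (sum_lt_sum (fun e he => ?_) ⟨r, by simp [hur, hrv], ?_⟩)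
      · simp only [mem_filter, mem_univ, true_and] at he
        exact hf.sum_side_le_of_eq_zero hT he.1 hu (hqS e he.1 he.2)
      · exact hf.sum_side_lt_of_eq_two hT hur hr0 (hqS r hur hrv) hr2
    · omega
  · have : 1 ≤ (q u : ℕ) := Nat.one_le_iff_ne_zero.2 fun h0 => hq0 (Fin.ext h0)
    split_ifs <;> omega

open Classical in
theorem two_le_card (hf : T.IsDeletionMinimal f) {v : V} (hv : f v = 2) :
    2 ≤ #{u | T.Adj v u ∧ f u = 0} := by
  -- After deletion of `v`, the vertices it dominated are given the value `1`.
  set g : V → Fin 3 := fun x => if T.Adj v x ∧ f x = 0 then 1 else f x with hg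
  have hg2 : ∀ x, g x = 2 ↔ f x = 2 := by
    intro x
    simp only [hg]
    split_ifs with hx
    · simp [hx.2]
    · rfl
  have hdom : T.IsPerfectRomanDominatingOn {v}ᶜ g := by
    intro x _ hx0
    have hx : ¬ (T.Adj v x ∧ f x = 0) := fun hx => by simp [hg, hx] at hx0
    have hfx : f x = 0 := by simpa only [hg, if_neg hx] using hx0
    obtain ⟨y, ⟨-, hxy, hy⟩, huniq⟩ := hf.dominating x (mem_univ x) hfx
    refine ⟨y, ⟨?_, hxy, (hg2 y).2 hy⟩, fun z hz => huniq z ⟨mem_univ z, hz.2.1, (hg2 z).1 hz.2.2⟩⟩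
    simp only [mem_compl, mem_singleton]
    rintro rfl
    exact hx ⟨hxy.symm, hfx⟩
  have hle := hf.le_compl v g hdom
  have hval : ∀ x, (g x : ℕ) = f x + if T.Adj v x ∧ f x = 0 then 1 else 0 := by
    intro x
    simp only [hg]
    split_ifs with hx
    · simp [hx.2]
    · simp
  rw [Fintype.sum_eq_add_sum_compl v, hv, sum_congr rfl fun x _ => hval x, sum_add_distrib,
    sum_boole, Nat.cast_id] at hle
  have hcard : #{x ∈ ({v}ᶜ : Finset V) | T.Adj v x ∧ f x = 0} ≤ #{u | T.Adj v u ∧ f u = 0} :=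
    card_le_card (filter_subset_filter _ (subset_univ _))
  simp only [Fin.val_two] at hle
  omega

open Classical in
theorem card_le_two (hf : T.IsDeletionMinimal f) (hT : T.IsTree) {v : V} (hv : f v = 2)
    (hq : T.IsPerfectRomanDominatingOn {v}ᶜ q)
    (hqw : ∑ x ∈ {v}ᶜ, (q x : ℕ) = ∑ x, (f x : ℕ)) :
    #{u | T.Adj v u ∧ f u = 0} ≤ 2 := by
  have hbranch : ∀ u ∈ ({u | T.Adj v u} : Finset V),
      ∑ x ∈ T.side v u, (f x : ℕ) + (if f u = 0 then 1 else 0) ≤ ∑ x ∈ T.side v u, (q x : ℕ) := by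
    intro u hu
    simp only [mem_filter, mem_univ, true_and] at hu
    have hvS := hT.notMem_side hu
    refine hf.sum_side_add_le hT hu hv (hq.mono (fun x hx => ?_) fun x hx y hy hy' hxy _ => ?_)
    · simp only [mem_compl, mem_singleton]
      rintro rfl
      exact hvS hx
    · simp only [mem_compl, mem_singleton] at hy
      exact absurd (hT.eq_of_adj_of_mem_side hu hx hy' hxy).2 hy
  have hsum := sum_le_sum hbranch
  rw [sum_add_distrib, ← hT.sum_compl_singleton v fun x => (q x : ℕ),
    ← hT.sum_compl_singleton v fun x => (f x : ℕ), hqw, Fintype.sum_eq_add_sum_compl v,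
    sum_boole, Nat.cast_id, filter_filter, hv] at hsum
  simp only [Fin.val_two] at hsum
  omega

/-- Every vertex of value `2` dominates exactly two vertices, so that the vertices are partitioned
into triples of weight `2`. -/
theorem exists_card_eq_three_mul (hf : T.IsDeletionMinimal f) (hT : T.IsTree)
    (hdel : ∀ v, ∃ q, T.IsPerfectRomanDominatingOn {v}ᶜ q ∧
      ∑ x ∈ {v}ᶜ, (q x : ℕ) = ∑ x, (f x : ℕ)) :
    ∃ m, Fintype.card V = 3 * m ∧ ∑ x, (f x : ℕ) = 2 * m := by
  classical
  refine ⟨#{v | f v = 2}, ?_, ?_⟩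
  · have hzero : #{x | f x = 0} = ∑ v with f v = 2, #{u | T.Adj v u ∧ f u = 0} := by
      rw [← card_biUnion]
      · congr 1
        ext x
        simp only [mem_filter, mem_univ, true_and, mem_biUnion]
        refine ⟨fun hx => ?_, fun ⟨_, _, _, hx⟩ => hx⟩
        obtain ⟨y, ⟨-, hxy, hy⟩, -⟩ := hf.dominating x (mem_univ x) hx
        exact ⟨y, hy, hxy.symm, hx⟩
      · intro v hv w hw hvw
        refine Finset.disjoint_left.2 ?_
        intro x hx hx'
        simp only [mem_filter, mem_univ, true_and, coe_filter, Set.mem_ofPred_eq] at hv hw hx hx'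
        exact hvw (hf.eq_of_adj hx.2 hx.1.symm hv hx'.1.symm hw)
    rw [sum_congr rfl fun v hv => by
      obtain ⟨q, hq, hqw⟩ := hdel v
      have hv2 := (mem_filter.1 hv).2
      exact (hf.card_le_two hT hv2 hq hqw).antisymm (hf.two_le_card hv2), sum_const,
      smul_eq_mul] at hzero
    have htwo : ({x | ¬ f x = 0} : Finset V) = ({v | f v = 2} : Finset V) := by
      ext x
      rcases hf.eq_zero_or_eq_two x with hx | hx <;> simp [hx]
    have hcard := card_filter_add_card_filter_not (s := (univ : Finset V)) fun x => f x = 0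
    rw [htwo, hzero, card_univ] at hcard
    omega
  · have : ∀ x, (f x : ℕ) = if f x = 2 then 2 else 0 := fun x => by
      rcases hf.eq_zero_or_eq_two x with hx | hx <;> simp [hx]
    rw [sum_congr rfl fun x _ => this x, ← sum_filter, sum_const, smul_eq_mul, mul_comm]

end IsDeletionMinimal
end DeletionMinimal

/-! ### Stable graphs -/

section Stable

variable {V : Type*} [Fintype V] [DecidableEq V] {G : SimpleGraph V}

theorem IsPerfectRomanDominatingOn.induce {v : V} {h : V → Fin 3}
    (hh : G.IsPerfectRomanDominatingOn {v}ᶜ h) :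
    (G.induce {w | w ≠ v}).IsPerfectRomanDominating fun x => h x := by
  rintro ⟨x, hx⟩ hx0
  obtain ⟨y, ⟨hy, hxy, hy2⟩, huniq⟩ := hh x (by simpa using hx) hx0
  refine ⟨⟨y, by simpa using hy⟩, ⟨hxy, hy2⟩, ?_⟩
  rintro ⟨z, hz⟩ ⟨hxz, hz2⟩
  exact Subtype.ext (huniq z ⟨by simpa using hz, hxz, hz2⟩)

theorem romanWeight_induce (v : V) (h : V → Fin 3) :
    romanWeight (fun x : {w | w ≠ v} => h x) = ∑ x ∈ {v}ᶜ, (h x : ℕ) := by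
  rw [romanWeight]
  exact (sum_subtype _ (by simp) fun x => (h x : ℕ)).symm

theorem perfectRomanDominationNumber_induce_le {v : V} {h : V → Fin 3}
    (hh : G.IsPerfectRomanDominatingOn {v}ᶜ h) :
    (G.induce {w | w ≠ v}).perfectRomanDominationNumber ≤ ∑ x ∈ {v}ᶜ, (h x : ℕ) :=
  (G.induce {w | w ≠ v}).isLeast_perfectRomanDominationNumber.2
    ⟨_, hh.induce, romanWeight_induce v h⟩

theorem exists_sum_eq_perfectRomanDominationNumber_induce (G : SimpleGraph V) (v : V) :
    ∃ h : V → Fin 3, G.IsPerfectRomanDominatingOn {v}ᶜ h ∧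
      ∑ x ∈ {v}ᶜ, (h x : ℕ) = (G.induce {w | w ≠ v}).perfectRomanDominationNumber := by
  obtain ⟨g, hg, hgw⟩ := (G.induce {w | w ≠ v}).isLeast_perfectRomanDominationNumber.1
  set h : V → Fin 3 := fun x => if hx : x ≠ v then g ⟨x, hx⟩ else 0 with hh
  have hgh : ∀ x : {w | w ≠ v}, h x = g x := fun x => dif_pos x.2
  refine ⟨h, ?_, ?_⟩
  · intro x hx hx0
    have hx' : x ≠ v := by simpa using hx
    obtain ⟨y, ⟨hxy, hy2⟩, huniq⟩ := hg ⟨x, hx'⟩ ((hgh ⟨x, hx'⟩).symm.trans hx0)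
    refine ⟨y, ⟨mem_compl.2 (notMem_singleton.2 y.2), hxy, (hgh y).trans hy2⟩, ?_⟩
    rintro z ⟨hz, hxz, hz2⟩
    have hz' : z ≠ v := by simpa using hz
    exact congrArg Subtype.val (huniq ⟨z, hz'⟩ ⟨hxz, (hgh ⟨z, hz'⟩).symm.trans hz2⟩)
  · rw [← hgw, ← romanWeight_induce]
    exact congrArg romanWeight (funext hgh)

theorem IsPerfectRomanDominationStable.isDeletionMinimal (hG : G.IsPerfectRomanDominationStable)
    {f : V → Fin 3} (hf : G.IsPerfectRomanDominating f)
    (hw : romanWeight f = G.perfectRomanDominationNumber) : G.IsDeletionMinimal f where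
  dominating := isPerfectRomanDominatingOn_univ.2 hf
  le_univ h hh := hw.le.trans (G.isLeast_perfectRomanDominationNumber.2
    ⟨h, isPerfectRomanDominatingOn_univ.1 hh, rfl⟩)
  le_compl v _ hh := hw.le.trans ((hG v).ge.trans (perfectRomanDominationNumber_induce_le hh))

end Stable

end SimpleGraph

theorem corollary1 {V : Type*} [Fintype V] [DecidableEq V] (T : SimpleGraph V) (n : ℕ)
    (hn : Fintype.card V = n) (hT : T.IsTree) (hstable : T.IsPerfectRomanDominationStable) :
    n ≡ 0 [MOD 3] ∧ (T.perfectRomanDominationNumber : ℚ) = 2 * (n : ℚ) / 3 := by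
  obtain ⟨f, hf, hfw⟩ := T.isLeast_perfectRomanDominationNumber.1
  obtain ⟨m, hm, hsum⟩ := (hstable.isDeletionMinimal hf hfw).exists_card_eq_three_mul hT fun v => by
    obtain ⟨q, hq, hqw⟩ := T.exists_sum_eq_perfectRomanDominationNumber_induce v
    exact ⟨q, hq, hqw.trans ((hstable v).trans hfw.symm)⟩
  have hγ : T.perfectRomanDominationNumber = 2 * m := hfw.symm.trans hsum
  refine ⟨(Nat.modEq_zero_iff_dvd).2 ⟨m, hn.symm.trans hm⟩, ?_⟩
  rw [hγ, ← hn, hm]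
  push_cast
  ring
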